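/- Let $d\ge 3$ and let $T_d$ be the $d$-regular tree, with vertex set $V(T_d)$. Let $M$ be a finite set, and let $Y=(Y_v)_{v\in V(T_d)}$ be an $M$-valued $\mathrm{Aut}(T_d)$-factor of IID process, i.e. $Y=F(Z)$, where $Z=(Z_v)_{v\in V(T_d)}$ are independent and uniform on $[0,1]$ and $F:[0,1]^{V(T_d)}\to M^{V(T_d)}$ is measurable and commutes with the natural actions of the full automorphism group $\mathrm{Aut}(T_d)$. For a finite set $S\subset V(T_d)$ let $H(S)$ denote the Shannon entropy of the joint distribution of $(Y_v)_{v\in S}$. Let $H(\mathrm{vertex})=H(\{v\})$ for a vertex $v$; let $H(\mathrm{flower}_i)=H(S)$ for a set $S$ of $i$ distinct neighbours of a vertex; and let $H(\mathrm{flower})=H(\mathrm{flower}_d)$ be the entropy of the set of all $d$ neighbours of a vertex. (By $\mathrm{Aut}(T_d)$-invariance these do not depend on the choices made; the inequalities below are asserted for all choices.) Then for every $1\le i<d$ $$(d-i)\,H(\mathrm{flower}_{i+1})\ \ge\ (d-i-1)\,H(\mathrm{flower}_i)+(d-1)\,H(\mathrm{vertex}),$$ and for every $1\le i\le d$ $$H(\mathrm{flower}_i)\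 \ge\ \frac{id-2i+1}{d-1}\,H(\mathrm{vertex});$$ in particular, $$H(\mathrm{flower})\ \ge\ (d-1)\,H(\mathrm{vertex}).$$ -/

import Mathlib

open MeasureTheory ProbabilityTheory

/-- The natural action of an automorphism `γ` of the graph `T` on labelings of its vertices:
`(γ · f)(v) = f (γ⁻¹ v)`. -/
def autAct {V A : Type*} {T : SimpleGraph V} (γ : T ≃g T) (f : V → A) : V → A :=
  fun v => f (γ.symm v)

/-- `F : A^V → M^V` is an `Aut(T)`-factor: it is measurable for the product σ-algebras and commutes
with the actions of the full automorphism group of `T`. -/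
structure IsAutFactor {V A M : Type*} [MeasurableSpace A] [MeasurableSpace M]
    (T : SimpleGraph V) (F : (V → A) → (V → M)) : Prop where
  measurable : Measurable F
  equivariant : ∀ (γ : T ≃g T) (z : V → A), F (autAct γ z) = autAct γ (F z)

/-- `Z = (Z_v)` is a family of independent random variables, each of them uniform on `[0,1]`. -/
structure IsIIDUniform {V Ω : Type*} [MeasurableSpace Ω] (P : Measure Ω)
    (Z : V → Ω → unitInterval) : Prop where
  measurable : ∀ v, Measurable (Z v)
  indep : iIndepFun Z P
  uniform : ∀ v, P.map (Z v) = volume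

/-- The process `Y = (Y_v)` is an `Aut(T)`-factor of IID: `Y = F(Z)` for some IID process `Z` with
uniform labels in `[0,1]` and some `Aut(T)`-factor `F`. -/
def IsFactorOfIID {V Ω M : Type*} [MeasurableSpace Ω] [MeasurableSpace M]
    (T : SimpleGraph V) (P : Measure Ω) (Y : V → Ω → M) : Prop :=
  ∃ (Z : V → Ω → unitInterval) (F : (V → unitInterval) → (V → M)),
    IsIIDUniform P Z ∧ IsAutFactor T F ∧ ∀ ω v, Y v ω = F (fun u => Z u ω) v

/-- Shannon entropy `-∑ μ(a) log μ(a)` (natural logarithm, `0 log 0 = 0`) of a distribution on a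
finite set. -/
noncomputable def shannonEntropy {α : Type*} [Fintype α] [MeasurableSpace α] (μ : Measure α) : ℝ :=
  ∑ a, Real.negMulLog (μ.real {a})

open Classical in
/-- `H(S)`: the entropy of the joint distribution of `Y_v`, `v ∈ S`, for a finite set `S`. -/
noncomputable def jointEntropy {V Ω M : Type*} [MeasurableSpace Ω] [Fintype M] [MeasurableSpace M]
    (P : Measure Ω) (Y : V → Ω → M) (S : Finset V) : ℝ :=
  shannonEntropy (P.map (fun (ω : Ω) (v : S) => Y v ω))

/-- `S` consists of exactly `i` neighbors of some vertex of `T`. -/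
def IsFlower {V : Type*} (T : SimpleGraph V) (i : ℕ) (S : Finset V) : Prop :=
  S.card = i ∧ ∃ o : V, ∀ v ∈ S, T.Adj o v

/-! Write c(S, A) for the entropy of Y_S given the seeds in A, and call c(S, A) - c(S, A ∪ D) the
gain of S from D given A. Gains grow with S. Since the seeds are independent, they also grow with A,
provided the enlarged A meets D only inside the old A (`gain_mono`).

Fix S inside the neighbourhood N of o and pass from B_m(o) to B_{m+1}(o) by revealing the balls
B_m(w), w ∈ N, one at a time. At each w, the gains of the sets S ∪ {x}, x ∈ N \ S, sum to at least
|N \ S| - 1 times the gain of S plus the gain of {w} (`sum_sdiff_insert_ge`). By symmetry the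
direction of o carries at most 1/d of what B_m(w) adds to B_{m-1}(w) about Y_w, so {w} gains at
least the fraction 1 - 1/d of it (`gain_succ_ge`). The d neighbours produce the factor d - 1, and
the sum over m telescopes (`sum_gain_finBall_ge`). As the balls exhaust the tree, gains become
entropies, because Y is a function of the seeds; all the S ∪ {x} have equal entropy by transitivity.

To keep every variable finite-valued, the seeds are truncated to n bits, with n growing along with
the radius. Truncation commutes with Aut(T), and Lévy's upward theorem makes the leftover
conditional entropies vanish (`tendsto_seedCondEntropy`). -/

namespace SimpleGraph
-- Distances and parents in a tree.
variable {V : Type*} {T : SimpleGraph V}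

/-- In a tree, a vertex has at most one neighbour closer to a given vertex. -/
lemma IsTree.eq_of_adj_of_dist_succ (hT : T.IsTree) {r v a b : V} (ha : T.Adj v a)
    (hb : T.Adj v b) (hda : T.dist r a + 1 = T.dist r v) (hdb : T.dist r b + 1 = T.dist r v) :
    a = b := by
  -- A geodesic to such an x followed by the edge to v is again a geodesic, and paths in a tree are
  -- unique.
  have key : ∀ x, T.Adj v x → T.dist r x + 1 = T.dist r v →
      ∃ p : T.Walk r v, p.IsPath ∧ p.penultimate = x := by
    intro x hx hd
    obtain ⟨p, hp⟩ := hT.connected.exists_walk_length_eq_dist r x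
    refine ⟨p.concat hx.symm, ?_, by simp⟩
    apply Walk.isPath_of_length_eq_dist
    rw [Walk.length_concat, hp, hd]
  obtain ⟨p, hp, rfl⟩ := key a ha hda
  obtain ⟨q, hq, rfl⟩ := key b hb hdb
  rw [(hT.existsUnique_path r v).unique hp hq]

lemma IsTree.dist_succ_or (hT : T.IsTree) (r : V) {v a : V} (ha : T.Adj v a) :
    T.dist r a + 1 = T.dist r v ∨ T.dist r a = T.dist r v + 1 := by
  have := hT.dist_eq_dist_add_one_of_adj r ha
  omega

lemma IsTree.exists_adj_dist_succ (hT : T.IsTree) {r v : V} (h : v ≠ r) :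
    ∃ a, T.Adj v a ∧ T.dist r a + 1 = T.dist r v := by
  obtain ⟨p, hp⟩ := hT.connected.exists_walk_length_eq_dist v r
  cases p with
  | nil => exact absurd rfl h
  | cons hx q =>
    rename_i x
    refine ⟨x, hx, ?_⟩
    have h1 := dist_le q
    rw [Walk.length_cons] at hp
    rcases hT.dist_succ_or r hx with h2 | h2 <;>
      rw [T.dist_comm (u := r) (v := x), T.dist_comm (u := r) (v := v)] at * <;> omega

/-- The neighbour of `v` towards the root `r` (junk value `r` at `r`). -/
noncomputable def IsTree.parent (hT : T.IsTree) (r v : V) : V :=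
  open Classical in if h : v = r then r else (hT.exists_adj_dist_succ h).choose

lemma IsTree.parent_spec (hT : T.IsTree) {r v : V} (h : v ≠ r) :
    T.Adj v (hT.parent r v) ∧ T.dist r (hT.parent r v) + 1 = T.dist r v := by
  rw [IsTree.parent, dif_neg h]
  exact (hT.exists_adj_dist_succ h).choose_spec

lemma IsTree.eq_parent (hT : T.IsTree) {r v a : V} (ha : T.Adj v a)
    (hd : T.dist r a + 1 = T.dist r v) : a = hT.parent r v := by
  have h : v ≠ r := by rintro rfl; simp at hd
  exact hT.eq_of_adj_of_dist_succ ha (hT.parent_spec h).1 hd (hT.parent_spec h).2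

lemma IsTree.adj_cases (hT : T.IsTree) (r : V) {v a : V} (ha : T.Adj v a) :
    (v ≠ r ∧ a = hT.parent r v) ∨
      (a ≠ r ∧ v = hT.parent r a ∧ T.dist r a = T.dist r v + 1) := by
  rcases hT.dist_succ_or r ha with h | h
  · exact Or.inl ⟨by rintro rfl; simp at h, hT.eq_parent ha h⟩
  · exact Or.inr ⟨by rintro rfl; simp at h, hT.eq_parent ha.symm h.symm, h⟩

/-! ### Automorphisms of a tree built from local bijections. -/

/-- The map obtained by propagating local neighbourhood maps from a root: the neighbours of the
root are mapped by `σ`, and a child of `v`, where `v` has parent `p`, by `β p v (f p) (f v)`. -/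
noncomputable def IsTree.propagate (hT : T.IsTree) (o o' : V) (σ : V → V)
    (β : V → V → V → V → V → V) (v : V) : V :=
  open Classical in
  if h : v = o then o' else
    if h' : hT.parent o v = o then σ v else
      β (hT.parent o (hT.parent o v)) (hT.parent o v)
        (hT.propagate o o' σ β (hT.parent o (hT.parent o v)))
        (hT.propagate o o' σ β (hT.parent o v)) v
termination_by T.dist o v
decreasing_by
  · have := (hT.parent_spec h).2
    have := (hT.parent_spec h').2
    omega
  · have := (hT.parent_spec h).2
    omega

section propagate
variable (hT : T.IsTree) {o o' : V} {σ : V → V} {β : V → V → V → V → V → V}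

lemma IsTree.propagate_root : hT.propagate o o' σ β o = o' := by
  rw [IsTree.propagate, dif_pos rfl]

lemma IsTree.propagate_adj_root {v : V} (h : T.Adj o v) : hT.propagate o o' σ β v = σ v := by
  have hp : o = hT.parent o v :=
    hT.eq_parent h.symm (by rw [dist_self, dist_eq_one_iff_adj.2 h])
  rw [IsTree.propagate, dif_neg h.ne', dif_pos hp.symm]

lemma IsTree.propagate_step {v : V} (h : v ≠ o) (h' : hT.parent o v ≠ o) :
    hT.propagate o o' σ β v = β (hT.parent o (hT.parent o v)) (hT.parent o v)
        (hT.propagate o o' σ β (hT.parent o (hT.parent o v)))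
        (hT.propagate o o' σ β (hT.parent o v)) v := by
  rw [IsTree.propagate, dif_neg h, dif_neg h']

variable (hσ : Set.BijOn σ (T.neighborSet o) (T.neighborSet o'))
  (hβ : ∀ p v q w, T.Adj v p → T.Adj w q →
    Set.BijOn (β p v q w) (T.neighborSet v) (T.neighborSet w) ∧ β p v q w p = q)
include hσ hβ

/-- By induction the images of v and its parent are adjacent, so `hβ` applies at v. Its clause `β p
v q w p = q` makes the local map at v agree with the propagated map on the parent too, not only on
the children. -/
lemma IsTree.bijOn_propagate (v : V) :
    Set.BijOn (hT.propagate o o' σ β) (T.neighborSet v)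
      (T.neighborSet (hT.propagate o o' σ β v)) := by
  induction hn : T.dist o v using Nat.strong_induction_on generalizing v with
  | _ n ih =>
    by_cases hv : v = o
    · subst hv
      rw [hT.propagate_root]
      exact hσ.congr fun x hx => (hT.propagate_adj_root hx).symm
    · obtain ⟨hadj, hd⟩ := hT.parent_spec hv
      have hp := ih _ (by omega) (hT.parent o v) rfl
      have hadj' := (hp.mapsTo hadj.symm).symm
      obtain ⟨h1, h2⟩ := hβ _ _ _ _ hadj hadj'
      refine h1.congr fun x hx => ?_
      rcases hT.adj_cases o hx with ⟨-, rfl⟩ | ⟨hx1, hx2, -⟩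
      · exact h2
      · rw [hT.propagate_step hx1 (hx2 ▸ hv), ← hx2]

lemma IsTree.dist_propagate (v : V) :
    T.dist o' (hT.propagate o o' σ β v) = T.dist o v ∧
      (v ≠ o → hT.propagate o o' σ β (hT.parent o v) =
        hT.parent o' (hT.propagate o o' σ β v)) := by
  induction hn : T.dist o v using Nat.strong_induction_on generalizing v with
  | _ n ih =>
    by_cases hv : v = o
    · subst hv
      rw [hT.propagate_root]
      simp [← hn]
    · obtain ⟨hadj, hd⟩ := hT.parent_spec hv
      set f := hT.propagate o o' σ β with hf
      set p := hT.parent o v with hp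
      have hb := hT.bijOn_propagate hσ hβ p
      have hadj' : T.Adj (f p) (f v) := hb.mapsTo hadj.symm
      obtain ⟨ih1, ih2⟩ := ih _ (by omega) p rfl
      rcases hT.adj_cases o' hadj' with ⟨h1, h2⟩ | ⟨h1, h2, h3⟩
      -- The image cannot backtrack: f v would be the image of the parent of p, and injectivity
      -- around p would make v that parent.
      · exfalso
        have hpo : p ≠ o := by
          intro h
          apply h1
          rw [h, hf, hT.propagate_root]
        obtain ⟨hadj2, hd2⟩ := hT.parent_spec hpo
        rw [← ih2 hpo] at h2
        have := hb.injOn hadj.symm hadj2 h2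
        rw [← this] at hd2
        omega
      · exact ⟨by omega, fun _ => h2⟩

/-- Equal images have equal depth and equal parents, so induction identifies the parents of a and b;
the map is injective on the neighbours of that common parent. -/
lemma IsTree.injective_propagate : Function.Injective (hT.propagate o o' σ β) := by
  intro a b hab
  induction hn : T.dist o a generalizing a b with
  | zero =>
    have h1 := (hT.dist_propagate hσ hβ a).1
    have h2 := (hT.dist_propagate hσ hβ b).1
    rw [← hab, h1, hn] at h2
    rw [← hT.connected.dist_eq_zero_iff.1 hn, ← hT.connected.dist_eq_zero_iff.1 h2.symm]
  | succ n ih =>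
    have h1 := (hT.dist_propagate hσ hβ a).1
    have h2 := (hT.dist_propagate hσ hβ b).1
    rw [← hab, h1, hn] at h2
    have ha : a ≠ o := by rintro rfl; simp at hn
    have hb : b ≠ o := by rintro rfl; simp at h2
    obtain ⟨pa, da⟩ := hT.parent_spec ha
    obtain ⟨pb, db⟩ := hT.parent_spec hb
    have e1 := (hT.dist_propagate hσ hβ a).2 ha
    have e2 := (hT.dist_propagate hσ hβ b).2 hb
    rw [← hab, ← e1] at e2
    have hpp := ih e2.symm (by omega)
    rw [← hpp] at pb
    exact (hT.bijOn_propagate hσ hβ _).injOn pa.symm pb.symm hab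

lemma IsTree.surjective_propagate : Function.Surjective (hT.propagate o o' σ β) := by
  intro y
  induction hn : T.dist o' y using Nat.strong_induction_on generalizing y with
  | _ n ih =>
    by_cases hy : y = o'
    · exact ⟨o, by rw [hT.propagate_root, hy]⟩
    · obtain ⟨hadj, hd⟩ := hT.parent_spec hy
      obtain ⟨v, hv⟩ := ih (T.dist o' (hT.parent o' y)) (by omega) _ rfl
      obtain ⟨x, -, hx⟩ := (hT.bijOn_propagate hσ hβ v).surjOn (hv ▸ hadj.symm)
      exact ⟨x, hx⟩

include hT
/-- The automorphism of a tree obtained by propagating bijections of neighbourhoods. -/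
lemma IsTree.exists_iso_of_bijOn :
    ∃ γ : T ≃g T, γ o = o' ∧ ∀ v, T.Adj o v → γ v = σ v := by
  refine ⟨⟨Equiv.ofBijective _ ⟨hT.injective_propagate hσ hβ, hT.surjective_propagate hσ hβ⟩, ?_⟩,
    hT.propagate_root, fun v hv => hT.propagate_adj_root hv⟩
  intro a b
  have hb := hT.bijOn_propagate hσ hβ a
  refine ⟨fun h => ?_, fun h => hb.mapsTo h⟩
  obtain ⟨x, hx, hxb⟩ := hb.surjOn h
  rwa [← hT.injective_propagate hσ hβ hxb]

end propagate

/-- Glues a bijection S → R to one of the complements. It serves both to move a flower and, with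
singletons, to prescribe the image of a parent. -/
lemma exists_bijOn_image_eq {α β : Type*} [Nonempty β] {A S : Finset α} {B R : Finset β}
    (hS : S ⊆ A) (hR : R ⊆ B) (hAB : A.card = B.card) (hSR : S.card = R.card) :
    ∃ f : α → β, Set.BijOn f A B ∧ f '' S = R := by
  classical
  have h1 : (A \ S).card = (B \ R).card := by
    rw [Finset.card_sdiff_of_subset hS, Finset.card_sdiff_of_subset hR, hAB, hSR]
  obtain ⟨f, hf⟩ := Set.Finite.exists_bijOn_of_encard_eq S.finite_toSet
    (t := (R : Set β)) (by simp [hSR])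
  obtain ⟨g, hg⟩ := Set.Finite.exists_bijOn_of_encard_eq (A \ S).finite_toSet
    (t := ((B \ R : Finset β) : Set β)) (by simp only [Set.encard_coe_eq_coe_finsetCard, h1])
  have e1 : Set.EqOn (fun x => if x ∈ S then f x else g x) f S := fun x hx => if_pos hx
  have e2 : Set.EqOn (fun x => if x ∈ S then f x else g x) g (A \ S : Finset α) :=
    fun x hx => if_neg (by simpa using (Finset.mem_sdiff.1 hx).2)
  have hf' := hf.congr e1.symm
  have hg' := hg.congr e2.symm
  refine ⟨fun x => if x ∈ S then f x else g x, ?_, hf'.image_eq⟩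
  have hA : (A : Set α) = (S : Set α) ∪ ((A \ S : Finset α) : Set α) := by
    rw [← Finset.coe_union, Finset.union_sdiff_of_subset hS]
  have hB : (B : Set β) = (R : Set β) ∪ ((B \ R : Finset β) : Set β) := by
    rw [← Finset.coe_union, Finset.union_sdiff_of_subset hR]
  rw [hA, hB]
  refine hf'.union hg' ?_
  rw [Set.injOn_union (by rw [Finset.disjoint_coe]; exact Finset.disjoint_sdiff)]
  refine ⟨hf'.injOn, hg'.injOn, fun x hx y hy h => ?_⟩
  have h1 := hf'.mapsTo hx
  have h2 := hg'.mapsTo hy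
  rw [← h] at h2
  exact (Finset.mem_sdiff.1 h2).2 h1

/-- The automorphism group of a regular tree is transitive on sets of `i` neighbours of a
vertex. -/
lemma IsTree.exists_iso_image_eq [T.LocallyFinite] {d : ℕ} (hT : T.IsTree)
    (hreg : T.IsRegularOfDegree d) {o o' : V} {S S' : Finset V} (hS : S ⊆ T.neighborFinset o)
    (hS' : S' ⊆ T.neighborFinset o') (hcard : S.card = S'.card) :
    ∃ γ : T ≃g T, γ o = o' ∧ γ '' (S : Set V) = S' := by
  have : Nonempty V := ⟨o⟩
  have hc : ∀ v w, (T.neighborFinset v).card = (T.neighborFinset w).card := fun v w => by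
    rw [card_neighborFinset_eq_degree, card_neighborFinset_eq_degree, hreg v, hreg w]
  obtain ⟨σ, hσ, hσS⟩ := exists_bijOn_image_eq hS hS' (hc o o') hcard
  have hβ : ∀ p v q w, ∃ f : V → V, T.Adj v p → T.Adj w q →
      Set.BijOn f (T.neighborSet v) (T.neighborSet w) ∧ f p = q := by
    intro p v q w
    by_cases h : T.Adj v p ∧ T.Adj w q
    · obtain ⟨f, hf, hfp⟩ := exists_bijOn_image_eq (S := {p}) (R := {q})
        (by simpa using h.1) (by simpa using h.2) (hc v w) rfl
      exact ⟨f, fun _ _ => ⟨by simpa using hf, by simpa using hfp⟩⟩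
    -- Junk value, making the choice of β total.
    · exact ⟨id, fun h1 h2 => absurd ⟨h1, h2⟩ h⟩
  choose β hβ using hβ
  obtain ⟨γ, h1, h2⟩ := hT.exists_iso_of_bijOn (o := o) (o' := o') (σ := σ) (by simpa using hσ) hβ
  refine ⟨γ, h1, ?_⟩
  rw [← hσS]
  exact Set.image_congr fun x hx => h2 x (by simpa using hS hx)

/-! ### Balls and their overlaps. -/

lemma Iso.dist_apply (γ : T ≃g T) (u v : V) : T.dist (γ u) (γ v) = T.dist u v := by
  have key : ∀ (γ : T ≃g T) (u v : V), T.edist (γ u) (γ v) ≤ T.edist u v := by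
    intro γ u v
    by_cases h : T.Reachable u v
    · obtain ⟨p, hp⟩ := h.exists_walk_length_eq_edist
      rw [← hp, ← Walk.length_map γ.toHom p]
      exact edist_le _
    · rw [edist_eq_top_of_not_reachable h]
      exact le_top
  rw [dist, dist, le_antisymm (key γ u v)
    (by simpa only [RelIso.symm_apply_apply] using key γ.symm (γ u) (γ v))]

open Classical in
/-- The ball of radius `n` around `v` in a locally finite graph. -/
noncomputable def finBall (T : SimpleGraph V) [T.LocallyFinite] : ℕ → V → Finset V
  | 0, v => {v}
  | n + 1, v => T.finBall n v ∪ (T.neighborFinset v).biUnion (T.finBall n)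

section finBall
variable [T.LocallyFinite]

lemma IsTree.mem_finBall (hT : T.IsTree) {n : ℕ} {v u : V} :
    u ∈ T.finBall n v ↔ T.dist v u ≤ n := by
  induction n generalizing v with
  | zero => simp [finBall, hT.connected.dist_eq_zero_iff, eq_comm]
  | succ n ih =>
    simp only [finBall, Finset.mem_union, Finset.mem_biUnion, ih, mem_neighborFinset]
    constructor
    · rintro (h | ⟨w, hw, h⟩)
      · omega
      · rcases hT.dist_succ_or u hw with h2 | h2 <;>
          rw [T.dist_comm (u := u) (v := w), T.dist_comm (u := u) (v := v)] at h2 <;> omega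
    · intro h
      by_cases hv : v = u
      · subst hv; simp
      · obtain ⟨w, hw, h2⟩ := hT.exists_adj_dist_succ hv
        rw [T.dist_comm (u := u) (v := w), T.dist_comm (u := u) (v := v)] at h2
        exact Or.inr ⟨w, hw, by omega⟩

lemma IsTree.map_finBall (hT : T.IsTree) (γ : T ≃g T) (n : ℕ) (v : V) :
    (T.finBall n v).map γ.toEquiv.toEmbedding = T.finBall n (γ v) := by
  ext u
  rw [Finset.mem_map_equiv, hT.mem_finBall, hT.mem_finBall, ← γ.dist_apply]
  exact iff_of_eq (congrArg (T.dist (γ v) · ≤ n) (γ.apply_symm_apply u))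

lemma IsTree.finBall_subset_succ (hT : T.IsTree) (n : ℕ) (v : V) :
    T.finBall n v ⊆ T.finBall (n + 1) v := fun u hu => by
  rw [hT.mem_finBall] at *
  omega

lemma IsTree.finBall_subset_of_adj (hT : T.IsTree) (n : ℕ) {v w : V} (h : T.Adj v w) :
    T.finBall n w ⊆ T.finBall (n + 1) v := fun u hu => by
  rw [hT.mem_finBall, T.dist_comm] at *
  have := hT.dist_succ_or u h
  omega

/-- In a tree, balls of the same radius around adjacent vertices meet in smaller balls. -/
lemma IsTree.finBall_inter_of_adj (hT : T.IsTree) (n : ℕ) {v w u : V} (h : T.Adj v w)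
    (hv : u ∈ T.finBall (n + 1) v) (hw : u ∈ T.finBall (n + 1) w) :
    u ∈ T.finBall n v ∨ u ∈ T.finBall n w := by
  simp only [hT.mem_finBall, T.dist_comm (v := u)] at *
  have := hT.dist_succ_or u h
  omega

/-- In a tree, balls of the same radius around two neighbours of `v` meet inside the ball of that
radius around `v`. -/
lemma IsTree.finBall_inter_of_adj_of_ne (hT : T.IsTree) (n : ℕ) {v w w' u : V} (h : T.Adj v w)
    (h' : T.Adj v w') (hne : w ≠ w') (hw : u ∈ T.finBall n w) (hw' : u ∈ T.finBall n w') :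
    u ∈ T.finBall n v := by
  simp only [hT.mem_finBall, T.dist_comm (v := u)] at *
  by_contra hc
  have h1 := hT.dist_succ_or u h
  have h2 := hT.dist_succ_or u h'
  exact hne (hT.eq_of_adj_of_dist_succ h h' (r := u) (by omega) (by omega))

lemma IsTree.exists_mem_finBall (hT : T.IsTree) (v u : V) : ∃ n, u ∈ T.finBall n v :=
  ⟨_, hT.mem_finBall.2 le_rfl⟩

end finBall

end SimpleGraph

/-! ### Information gains under successive revealing of seeds. -/

open Finset in
-- Every summand is at least g S. If w ∉ S, the summand x = w is bounded by g {w} instead; if w ∈ S,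
-- one copy of g S pays for g {w}.
lemma sum_sdiff_insert_ge {V : Type*} [DecidableEq V] {g : Finset V → ℝ}
    (hg : ∀ ⦃S S'⦄, S ⊆ S' → g S ≤ g S') {N S : Finset V} {w : V} (hw : w ∈ N) :
    ((N \ S).card - 1 : ℝ) * g S + g {w} ≤ ∑ x ∈ N \ S, g (insert x S) := by
  by_cases hwS : w ∈ S
  · have h1 : ((N \ S).card : ℝ) * g S ≤ ∑ x ∈ N \ S, g (insert x S) := by
      rw [← nsmul_eq_mul]
      exact card_nsmul_le_sum _ _ _ fun x _ => hg (subset_insert x S)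
    have h2 : g {w} ≤ g S := hg (singleton_subset_iff.2 hwS)
    linarith
  · have hwN : w ∈ N \ S := mem_sdiff.2 ⟨hw, hwS⟩
    rw [← add_sum_erase _ _ hwN]
    have h1 : (((N \ S).erase w).card : ℝ) * g S ≤ ∑ x ∈ (N \ S).erase w, g (insert x S) := by
      rw [← nsmul_eq_mul]
      exact card_nsmul_le_sum _ _ _ fun x _ => hg (subset_insert x S)
    rw [card_erase_of_mem hwN, Nat.cast_sub (card_pos.2 ⟨w, hwN⟩), Nat.cast_one] at h1
    have h2 : g {w} ≤ g (insert w S) := hg (by simp)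
    linarith

/-- Abstract conditional entropies `c S A` of a process on the vertex set `S`, given independent
seeds on `A`, invariant under the automorphisms of the graph `T`. -/
structure IsInvariantCondEntropy {V : Type*} [DecidableEq V] (T : SimpleGraph V)
    (c : Finset V → Finset V → ℝ) : Prop where
  sub_mono : ∀ ⦃S S' : Finset V⦄, S ⊆ S' → ∀ A D, c S A - c S (A ∪ D) ≤ c S' A - c S' (A ∪ D)
  submodular : ∀ S A B, c S (A ∪ B) + c S (A ∩ B) ≤ c S A + c S B
  empty : ∀ A, c ∅ A = 0
  nonneg : ∀ S A, 0 ≤ c S A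
  map : ∀ (γ : T ≃g T) (S A : Finset V),
    c (S.map γ.toEquiv.toEmbedding) (A.map γ.toEquiv.toEmbedding) = c S A

namespace IsInvariantCondEntropy
open Finset
variable {V : Type*} [DecidableEq V] {T : SimpleGraph V} {c : Finset V → Finset V → ℝ}
  (hc : IsInvariantCondEntropy T c)
include hc

lemma antitone (S A D : Finset V) : c S (A ∪ D) ≤ c S A := by
  have := hc.sub_mono (empty_subset S) A D
  rw [hc.empty, hc.empty] at this
  linarith

/-- More conditioning increases the information gained from a further set of seeds. -/
lemma gain_mono (S : Finset V) {A A' D : Finset V} (h : A ⊆ A') (hD : A' ∩ D ⊆ A) :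
    c S A - c S (A ∪ D) ≤ c S A' - c S (A' ∪ D) := by
  have h1 := hc.submodular S A' (A ∪ D)
  rw [← union_assoc, union_eq_left.2 h,
    show A' ∩ (A ∪ D) = A by
      rw [inter_union_distrib_left, inter_eq_right.2 h, union_eq_left.2 hD]] at h1
  linarith

/-- The sets E w are added one at a time; as they overlap only inside A, those already added can
only increase the next gain. -/
lemma sum_gain_le (S : Finset V) {N : Finset V} {A : Finset V} (E : V → Finset V)
    (hE : ∀ w ∈ N, ∀ w' ∈ N, w ≠ w' → E w ∩ E w' ⊆ A) :
    ∑ w ∈ N, (c S A - c S (A ∪ E w)) ≤ c S A - c S (A ∪ N.biUnion E) := by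
  induction N using Finset.induction_on with
  | empty => simp
  | insert w N hw ih =>
    rw [sum_insert hw, biUnion_insert, union_comm (E w), ← union_assoc]
    have h1 := ih fun x hx y hy => hE x (mem_insert_of_mem hx) y (mem_insert_of_mem hy)
    have h2 := hc.gain_mono S (A := A) (A' := A ∪ N.biUnion E) (D := E w) subset_union_left (by
      rw [union_inter_distrib_right, biUnion_inter]
      refine union_subset inter_subset_left (biUnion_subset.2 fun x hx => ?_)
      exact hE x (mem_insert_of_mem hx) w (mem_insert_self _ _) (by rintro rfl; exact hw hx))
    linarith

/-- The sets D w are revealed in turn, with `sum_sdiff_insert_ge` applied to the gain at each step;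
the sets revealed earlier only help {w}. W is the part of N treated so far. -/
lemma sum_gain_insert_ge {N S W : Finset V} (hW : W ⊆ N)
    (A : Finset V) (D : V → Finset V) (hD : ∀ w ∈ N, ∀ w' ∈ N, w ≠ w' → D w ∩ D w' ⊆ A) :
    ((N \ S).card - 1 : ℝ) * (c S A - c S (A ∪ W.biUnion D)) +
      ∑ w ∈ W, (c {w} A - c {w} (A ∪ D w)) ≤
    ∑ x ∈ N \ S, (c (insert x S) A - c (insert x S) (A ∪ W.biUnion D)) := by
  induction W using Finset.induction_on with
  | empty => simp
  | insert w W hw ih =>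
    have ih := ih fun x hx => hW (mem_insert_of_mem hx)
    rw [sum_insert hw, biUnion_insert, union_comm (D w), ← union_assoc]
    set A' := A ∪ W.biUnion D with hA'
    have hwN := hW (mem_insert_self w W)
    have h1 := sum_sdiff_insert_ge (S := S) (g := fun S => c S A' - c S (A' ∪ D w))
      (fun S S' h => hc.sub_mono h A' (D w)) hwN
    have h2 := hc.gain_mono {w} (A := A) (A' := A') (D := D w) subset_union_left (by
      rw [hA', union_inter_distrib_right, biUnion_inter]
      refine union_subset inter_subset_left (biUnion_subset.2 fun x hx => ?_)
      exact hD x (hW (mem_insert_of_mem hx)) w hwN (by rintro rfl; exact hw hx))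
    simp only [sum_sub_distrib] at *
    linarith

variable [T.LocallyFinite] {d : ℕ} (hT : T.IsTree) (hreg : T.IsRegularOfDegree d)
include hT hreg

/-- The stabiliser of w is transitive on its neighbours, which gives the equal shares in
`gain_succ_ge`. -/
lemma eq_of_adj (n m : ℕ) {w x y : V} (hx : T.Adj w x) (hy : T.Adj w y) :
    c {w} (T.finBall n w ∪ T.finBall m x) = c {w} (T.finBall n w ∪ T.finBall m y) := by
  obtain ⟨γ, h1, h2⟩ := hT.exists_iso_image_eq hreg (o := w) (o' := w) (S := {x}) (S' := {y})
    (by simpa using hx) (by simpa using hy) rfl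
  have h3 : γ x = y := by simpa using h2
  rw [← hc.map γ, map_union, hT.map_finBall, hT.map_finBall, map_singleton, h1, h3]
  exact congrArg (fun z => c {z} _) h1

lemma eq_finBall (n : ℕ) (v w : V) : c {v} (T.finBall n v) = c {w} (T.finBall n w) := by
  obtain ⟨γ, h1, -⟩ := hT.exists_iso_image_eq hreg (o := v) (o' := w) (S := ∅) (S' := ∅)
    (by simp) (by simp) rfl
  rw [← hc.map γ, hT.map_finBall, map_singleton, h1]
  exact congrArg (fun z => c {z} _) h1

lemma eq_vertex (v w : V) : c {v} ∅ = c {w} ∅ := by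
  obtain ⟨γ, h1, -⟩ := hT.exists_iso_image_eq hreg (o := v) (o' := w) (S := ∅) (S' := ∅)
    (by simp) (by simp) rfl
  rw [← hc.map γ, map_singleton, map_empty]
  exact congrArg (fun z => c {z} _) h1

lemma eq_of_card_eq {o o' : V} {S S' : Finset V} (hS : S ⊆ T.neighborFinset o)
    (hS' : S' ⊆ T.neighborFinset o') (hcard : S.card = S'.card) : c S ∅ = c S' ∅ := by
  obtain ⟨γ, -, h2⟩ := hT.exists_iso_image_eq hreg hS hS' hcard
  rw [← hc.map γ, map_empty]
  congr 1
  rw [← coe_inj, ← h2, coe_map]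
  rfl

omit hreg in
omit hT hc in
-- Not definitional here, since `finBall` is built with classical decidability of equality.
lemma finBall_succ_eq (n : ℕ) (v : V) :
    T.finBall (n + 1) v = T.finBall n v ∪ (T.neighborFinset v).biUnion (T.finBall n) := by
  ext
  simp [SimpleGraph.finBall]

/-- The information on `w` in the ball of radius `n + 1` around `w`, outside the ball around the
neighbour `o`, is at least its share by symmetry. -/
lemma gain_succ_ge (hd : 0 < d) (n : ℕ) {o w : V} (h : T.Adj o w) :
    (1 - 1 / d : ℝ) * (c {w} (T.finBall n w) - c {w} (T.finBall (n + 1) w)) ≤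
      c {w} (T.finBall (n + 1) o) - c {w} (T.finBall (n + 1) o ∪ T.finBall (n + 1) w) := by
  -- Beyond B_n(w), the n-balls of the d neighbours of w are disjoint and have equal gains, so each
  -- gain is at most 1/d of the total.
  have h1 := hc.sum_gain_le {w} (N := T.neighborFinset w) (A := T.finBall n w) (T.finBall n) (by
    intro x hx y hy hne u hu
    rw [mem_inter] at hu
    exact hT.finBall_inter_of_adj_of_ne n (by simpa using hx) (by simpa using hy) hne hu.1 hu.2)
  rw [← finBall_succ_eq, sum_congr rfl (g := fun _ =>
    c {w} (T.finBall n w) - c {w} (T.finBall n w ∪ T.finBall n o)) (fun x hx => by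
      rw [hc.eq_of_adj hT hreg n n (by simpa using hx) h.symm]), sum_const, nsmul_eq_mul,
    SimpleGraph.card_neighborFinset_eq_degree, hreg w] at h1
  -- B_{n+1}(o) meets B_{n+1}(w) only in B_n(w) ∪ B_n(o), so conditioning on the larger ball does
  -- not lower the gain.
  have h2 := hc.gain_mono {w} (A := T.finBall n w ∪ T.finBall n o) (A' := T.finBall (n + 1) o)
    (D := T.finBall (n + 1) w)
    (union_subset (hT.finBall_subset_of_adj n h) (hT.finBall_subset_succ n o)) (by
      intro u hu
      rw [mem_inter] at hu
      rw [mem_union]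
      exact (hT.finBall_inter_of_adj n h hu.1 hu.2).symm)
  rw [union_eq_right.2 (union_subset (hT.finBall_subset_succ n w)
    (hT.finBall_subset_of_adj n h.symm))] at h2
  refine le_trans ?_ h2
  have hd' : (0 : ℝ) < d := by exact_mod_cast hd
  rw [← le_div_iff₀' hd'] at h1
  have h3 : (1 - 1 / d : ℝ) * (c {w} (T.finBall n w) - c {w} (T.finBall (n + 1) w)) =
      (c {w} (T.finBall n w) - c {w} (T.finBall (n + 1) w)) -
      (c {w} (T.finBall n w) - c {w} (T.finBall (n + 1) w)) / d := by ring
  rw [h3]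
  linarith

omit hT hreg in
-- At radius 0 the two balls are disjoint and nothing is lost; the factor 1 - 1/d is a weakening
-- that matches the later rounds of the telescoping sum.
lemma gain_zero_ge (hd : 0 < d) {o w : V} (h : T.Adj o w) :
    (1 - 1 / d : ℝ) * (c {w} ∅ - c {w} (T.finBall 0 w)) ≤
      c {w} (T.finBall 0 o) - c {w} (T.finBall 0 o ∪ T.finBall 0 w) := by
  have h1 := hc.gain_mono {w} (A := ∅) (A' := T.finBall 0 o) (D := T.finBall 0 w)
    (empty_subset _) (by simp [SimpleGraph.finBall, h.ne])
  have h2 := hc.antitone {w} ∅ (T.finBall 0 w)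
  rw [empty_union] at h1 h2
  have h3 : (0 : ℝ) ≤ 1 / d * (c {w} ∅ - c {w} (T.finBall 0 w)) :=
    mul_nonneg (by positivity) (by linarith)
  linarith

/-- Each round adds d (1 - 1/d) = d - 1 times one increment of the information on a vertex, and the
increments telescope. The ball around o is one larger than the one around v because it contains the
n-balls of the neighbours. -/
lemma sum_gain_finBall_ge (hd : 0 < d) (o : V) (S : Finset V) (v : V) (n : ℕ) :
    (((T.neighborFinset o \ S).card - 1 : ℝ) * (c S ∅ - c S (T.finBall (n + 1) o)) +
      (d - 1) * (c {v} ∅ - c {v} (T.finBall n v))) ≤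
    ∑ x ∈ T.neighborFinset o \ S, (c (insert x S) ∅ - c (insert x S) (T.finBall (n + 1) o)) := by
  have hcard : (T.neighborFinset o).card = d := by
    rw [SimpleGraph.card_neighborFinset_eq_degree, hreg o]
  have hd' : (d : ℝ) * (1 - 1 / d) = d - 1 := by
    field_simp
  have hD : ∀ m, ∀ w ∈ T.neighborFinset o, ∀ w' ∈ T.neighborFinset o, w ≠ w' →
      T.finBall m w ∩ T.finBall m w' ⊆ T.finBall m o := fun m w hw w' hw' hne u hu => by
    rw [mem_inter] at hu
    exact hT.finBall_inter_of_adj_of_ne m (by simpa using hw) (by simpa using hw') hne hu.1 hu.2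
  have step := fun m => hc.sum_gain_insert_ge (S := S) (subset_refl _) (T.finBall m o)
    (T.finBall m) (hD m)
  simp only [← finBall_succ_eq] at step
  induction n with
  | zero =>
    obtain ⟨w, hw⟩ : (T.neighborFinset o).Nonempty := card_pos.1 (by omega)
    -- Revealing the seed at o alone; its contribution to the vertex term is nonnegative and is
    -- dropped.
    have h0 := sum_sdiff_insert_ge (S := S) (g := fun S => c S ∅ - c S (∅ ∪ T.finBall 0 o))
      (fun S S' h => hc.sub_mono h ∅ (T.finBall 0 o)) hw
    have h1 := hc.antitone {w} ∅ (T.finBall 0 o)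
    have h2 : ∑ x ∈ T.neighborFinset o, (1 - 1 / d : ℝ) * (c {v} ∅ - c {v} (T.finBall 0 v)) ≤
        ∑ w ∈ T.neighborFinset o,
          (c {w} (T.finBall 0 o) - c {w} (T.finBall 0 o ∪ T.finBall 0 w)) :=
      sum_le_sum fun x hx => by
        rw [hc.eq_vertex hT hreg v x, hc.eq_finBall hT hreg 0 v x]
        exact hc.gain_zero_ge hd (by simpa using hx)
    have h3 := step 0
    rw [sum_const, nsmul_eq_mul, hcard, ← mul_assoc, hd'] at h2
    simp only [sum_sub_distrib, empty_union] at *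
    linarith
  | succ n ih =>
    have h2 : ∑ x ∈ T.neighborFinset o,
        (1 - 1 / d : ℝ) * (c {v} (T.finBall n v) - c {v} (T.finBall (n + 1) v)) ≤
        ∑ w ∈ T.neighborFinset o,
          (c {w} (T.finBall (n + 1) o) - c {w} (T.finBall (n + 1) o ∪ T.finBall (n + 1) w)) :=
      sum_le_sum fun x hx => by
        rw [hc.eq_finBall hT hreg n v x, hc.eq_finBall hT hreg (n + 1) v x]
        exact hc.gain_succ_ge hT hreg hd n (by simpa using hx)
    have h3 := step (n + 1)
    rw [sum_const, nsmul_eq_mul, hcard, ← mul_assoc, hd'] at h2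
    simp only [sum_sub_distrib] at *
    linarith

/-- The flower inequality, up to the entropies that remain after the seeds in large balls are
known. -/
lemma flower_ge {o o' : V} {S S' : Finset V} (hS : S ⊆ T.neighborFinset o)
    (hS' : S' ⊆ T.neighborFinset o') (hcard : S'.card = S.card + 1) (v : V) (n : ℕ) :
    ((d : ℝ) - S.card - 1) * (c S ∅ - c S (T.finBall (n + 1) o)) +
      (d - 1) * (c {v} ∅ - c {v} (T.finBall n v)) ≤ (d - S.card) * c S' ∅ := by
  have hN : ∀ o, (T.neighborFinset o).card = d := fun o => by
    rw [SimpleGraph.card_neighborFinset_eq_degree, hreg o]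
  have hlt : S.card < d := by
    have := card_le_card hS'
    rw [hN] at this
    omega
  have h1 := hc.sum_gain_finBall_ge hT hreg (by omega) o S v n
  -- The leftover conditional entropies on this side are dropped by nonnegativity, so only those of
  -- S and v must vanish in the limit.
  have h2 : ∑ x ∈ T.neighborFinset o \ S,
      (c (insert x S) ∅ - c (insert x S) (T.finBall (n + 1) o)) ≤
      ∑ x ∈ T.neighborFinset o \ S, c S' ∅ := by
    refine sum_le_sum fun x hx => ?_
    rw [mem_sdiff] at hx
    rw [hc.eq_of_card_eq hT hreg (insert_subset hx.1 hS) hS'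
      (by rw [card_insert_of_notMem hx.2, hcard])]
    linarith [hc.nonneg (insert x S) (T.finBall (n + 1) o)]
  rw [sum_const, nsmul_eq_mul] at h2
  rw [card_sdiff_of_subset hS, hN, Nat.cast_sub hlt.le] at h1 h2
  linarith

end IsInvariantCondEntropy

/-! ### Shannon entropy of finite-valued variables. -/

open Real in
/-- Submodularity of entropy, for a finite family `p` of masses with marginals `pA`, `pB` and a
common image `pZ` of these marginals. -/
lemma negMulLog_submodular {α β γ : Type*} [Fintype α] [Fintype β] [Fintype γ] [DecidableEq γ]
    {p : α → β → ℝ} (hp : ∀ a b, 0 ≤ p a b) {f : α → γ} {g : β → γ}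
    (hfg : ∀ a b, p a b ≠ 0 → f a = g b) {pA : α → ℝ} {pB : β → ℝ} {pZ : γ → ℝ}
    (hA : ∀ a, pA a = ∑ b, p a b) (hB : ∀ b, pB b = ∑ a, p a b)
    (hZA : ∀ z, pZ z = ∑ a with f a = z, pA a) (hZB : ∀ z, pZ z = ∑ b with g b = z, pB b) :
    ∑ a, ∑ b, negMulLog (p a b) + ∑ z, negMulLog (pZ z) ≤
      ∑ a, negMulLog (pA a) + ∑ b, negMulLog (pB b) := by
  have hA0 : ∀ a, 0 ≤ pA a := fun a => hA a ▸ Finset.sum_nonneg fun b _ => hp a b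
  have hB0 : ∀ b, 0 ≤ pB b := fun b => hB b ▸ Finset.sum_nonneg fun a _ => hp a b
  have hpA : ∀ a b, p a b ≤ pA a := fun a b =>
    hA a ▸ Finset.single_le_sum (fun b _ => hp a b) (Finset.mem_univ b)
  have hpB : ∀ a b, p a b ≤ pB b := fun a b =>
    hB b ▸ Finset.single_le_sum (f := fun a => p a b) (fun a _ => hp a b) (Finset.mem_univ a)
  have hAZ : ∀ a, pA a ≤ pZ (f a) := fun a =>
    hZA (f a) ▸ Finset.single_le_sum (fun a _ => hA0 a) (by simp)
  have eA : ∑ a, negMulLog (pA a) = ∑ a, ∑ b, -(p a b * log (pA a)) := by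
    refine Finset.sum_congr rfl fun a _ => ?_
    rw [Finset.sum_neg_distrib, ← Finset.sum_mul, ← hA, negMulLog, neg_mul]
  have eB : ∑ b, negMulLog (pB b) = ∑ a, ∑ b, -(p a b * log (pB b)) := by
    rw [Finset.sum_comm]
    refine Finset.sum_congr rfl fun b _ => ?_
    rw [Finset.sum_neg_distrib, ← Finset.sum_mul, ← hB, negMulLog, neg_mul]
  have eZ : ∑ z, negMulLog (pZ z) = ∑ a, ∑ b, -(p a b * log (pZ (f a))) := by
    rw [← Finset.sum_fiberwise Finset.univ f]
    refine Finset.sum_congr rfl fun z _ => ?_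
    rw [negMulLog, neg_mul]
    nth_rw 1 [hZA z]
    rw [Finset.sum_mul, ← Finset.sum_neg_distrib]
    refine Finset.sum_congr rfl fun a ha => ?_
    rw [(Finset.mem_filter.1 ha).2, Finset.sum_neg_distrib, ← Finset.sum_mul, ← hA]
  -- Gibbs' inequality against the coupling that makes the two variables conditionally independent
  -- given their common image.
  have hq : ∑ a, ∑ b, (if g b = f a then pA a * pB b / pZ (f a) else 0) ≤ ∑ a, ∑ b, p a b := by
    refine Finset.sum_le_sum fun a _ => ?_
    rw [← Finset.sum_filter, ← Finset.sum_div, ← Finset.mul_sum, ← hZB, ← hA]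
    rcases eq_or_ne (pZ (f a)) 0 with h | h
    · rw [h, div_zero]; exact hA0 a
    · rw [mul_div_cancel_right₀ _ h]
  have hterm : ∀ a b, p a b - (if g b = f a then pA a * pB b / pZ (f a) else 0) ≤
      -(p a b * log (pA a)) + -(p a b * log (pB b)) - negMulLog (p a b) -
        -(p a b * log (pZ (f a))) := by
    intro a b
    rcases eq_or_ne (p a b) 0 with h | h
    · have : 0 ≤ if g b = f a then pA a * pB b / pZ (f a) else 0 := by
        have := hA0 a
        have := hB0 b
        have := (hA0 a).trans (hAZ a)
        positivity
      simp only [h, zero_mul, negMulLog_zero]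
      linarith
    · have h0 := lt_of_le_of_ne (hp a b) h.symm
      have h1 := h0.trans_le (hpA a b)
      have h2 := h0.trans_le (hpB a b)
      have h3 := h1.trans_le (hAZ a)
      rw [if_pos (hfg a b h).symm]
      have h4 := mul_le_mul_of_nonneg_left (one_sub_inv_le_log_of_pos
        (show 0 < p a b * pZ (f a) / (pA a * pB b) by positivity)) h0.le
      rw [log_div (by positivity) (by positivity), log_mul h0.ne' h3.ne', log_mul h1.ne' h2.ne',
        mul_sub, mul_one, inv_div, mul_div_mul_comm, ← mul_assoc] at h4
      have h5 : p a b * (pA a / p a b) * (pB b / pZ (f a)) = pA a * pB b / pZ (f a) := by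
        field_simp
      rw [h5] at h4
      rw [negMulLog]
      linarith
  have := Finset.sum_le_sum fun a (_ : a ∈ Finset.univ) =>
    Finset.sum_le_sum fun b (_ : b ∈ Finset.univ) => hterm a b
  simp only [Finset.sum_add_distrib, Finset.sum_sub_distrib] at this
  rw [eA, eB, eZ]
  linarith

section
variable {Ω α β γ : Type*} [MeasurableSpace Ω] {P : Measure Ω} [IsProbabilityMeasure P]
  [Fintype α] [MeasurableSpace α] [DiscreteMeasurableSpace α]
  [Fintype β] [MeasurableSpace β] [DiscreteMeasurableSpace β]
  [Fintype γ] [MeasurableSpace γ] [DiscreteMeasurableSpace γ]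

open Real in
omit [IsProbabilityMeasure P] in
lemma shannonEntropy_map {X : Ω → α} (hX : Measurable X) :
    shannonEntropy (P.map X) = ∑ a, negMulLog (P.real (X ⁻¹' {a})) := by
  refine Finset.sum_congr rfl fun a _ => ?_
  rw [map_measureReal_apply hX (measurableSet_singleton a)]

omit [Fintype γ] [MeasurableSpace γ] [DiscreteMeasurableSpace γ] in
lemma measureReal_preimage_comp [DecidableEq γ] {X : Ω → α} (hX : Measurable X) (f : α → γ)
    (z : γ) :
    P.real ((fun ω => f (X ω)) ⁻¹' {z}) = ∑ a with f a = z, P.real (X ⁻¹' {a}) := by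
  rw [sum_measureReal_preimage_singleton _ fun a _ => hX (measurableSet_singleton a)]
  congr 1
  ext ω
  simp

lemma measureReal_eq_sum_prod_right {X : Ω → α} {Y : Ω → β} (hX : Measurable X)
    (hY : Measurable Y) (a : α) :
    P.real (X ⁻¹' {a}) = ∑ b, P.real ((fun ω => (X ω, Y ω)) ⁻¹' {(a, b)}) := by
  classical
  have h := measureReal_preimage_comp (P := P) (hX.prodMk hY) Prod.fst a
  rw [Finset.sum_filter, Fintype.sum_prod_type, Finset.sum_comm] at h
  simpa using h

lemma measureReal_eq_sum_prod_left {X : Ω → α} {Y : Ω → β} (hX : Measurable X)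
    (hY : Measurable Y) (b : β) :
    P.real (Y ⁻¹' {b}) = ∑ a, P.real ((fun ω => (X ω, Y ω)) ⁻¹' {(a, b)}) := by
  classical
  have h := measureReal_preimage_comp (P := P) (hX.prodMk hY) Prod.snd b
  rw [Finset.sum_filter, Fintype.sum_prod_type] at h
  simpa using h

lemma sum_measureReal_preimage_eq_one {X : Ω → α} (hX : Measurable X) :
    ∑ a, P.real (X ⁻¹' {a}) = 1 := by
  rw [sum_measureReal_preimage_singleton _ fun a _ => hX (measurableSet_singleton a)]
  simp

omit [IsProbabilityMeasure P] in
lemma shannonEntropy_map_comp_injective {X : Ω → α} (hX : Measurable X) {f : α → γ}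
    (hf : Function.Injective f) :
    shannonEntropy (P.map fun ω => f (X ω)) = shannonEntropy (P.map X) := by
  have hfX : Measurable fun ω => f (X ω) := (measurable_of_finite f).comp hX
  rw [shannonEntropy_map hX, shannonEntropy_map hfX]
  refine (Fintype.sum_of_injective f hf _ _ (fun z hz => ?_) fun a => ?_).symm
  · rw [show (fun ω => f (X ω)) ⁻¹' {z} = ∅ by
      ext ω; simpa using fun h => hz ⟨X ω, h⟩]
    simp
  · congr 2
    ext ω
    simp [hf.eq_iff]

lemma shannonEntropy_submodular {X : Ω → α} {Y : Ω → β} (hX : Measurable X) (hY : Measurable Y)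
    {f : α → γ} {g : β → γ} (hfg : ∀ ω, f (X ω) = g (Y ω)) :
    shannonEntropy (P.map fun ω => (X ω, Y ω)) + shannonEntropy (P.map fun ω => f (X ω)) ≤
      shannonEntropy (P.map X) + shannonEntropy (P.map Y) := by
  classical
  have hXY : Measurable fun ω => (X ω, Y ω) := hX.prodMk hY
  have hfX : Measurable fun ω => f (X ω) := (measurable_of_finite f).comp hX
  rw [shannonEntropy_map hX, shannonEntropy_map hY, shannonEntropy_map hXY,
    shannonEntropy_map hfX, Fintype.sum_prod_type]
  refine negMulLog_submodular (fun a b => measureReal_nonneg) (f := f) (g := g)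
    (fun a b h => ?_) (measureReal_eq_sum_prod_right hX hY)
    (measureReal_eq_sum_prod_left hX hY) (measureReal_preimage_comp hX f) fun z => ?_
  · by_contra hne
    apply h
    rw [show (fun ω => (X ω, Y ω)) ⁻¹' {(a, b)} = ∅ by
      ext ω
      simp only [Set.mem_preimage, Set.mem_singleton_iff, Prod.mk.injEq, Set.mem_empty_iff_false,
        iff_false]
      rintro ⟨rfl, rfl⟩
      exact hne (hfg ω)]
    simp
  · simp only [hfg]
    exact measureReal_preimage_comp hY g z

/-- Submodularity with Y = X, since the pair (X, X) carries the entropy of X. -/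
lemma shannonEntropy_map_comp_le {X : Ω → α} (hX : Measurable X) (f : α → γ) :
    shannonEntropy (P.map fun ω => f (X ω)) ≤ shannonEntropy (P.map X) := by
  have h1 := shannonEntropy_submodular (P := P) hX hX (f := f) (g := f) fun _ => rfl
  have h2 := shannonEntropy_map_comp_injective (P := P) hX (f := fun a => (a, a))
    fun a b h => (Prod.mk.inj h).1
  linarith

lemma shannonEntropy_prod_of_indepFun {X : Ω → α} {Y : Ω → β} (hX : Measurable X)
    (hY : Measurable Y) (h : IndepFun X Y P) :
    shannonEntropy (P.map fun ω => (X ω, Y ω)) =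
      shannonEntropy (P.map X) + shannonEntropy (P.map Y) := by
  have hXY : Measurable fun ω => (X ω, Y ω) := hX.prodMk hY
  rw [shannonEntropy_map hX, shannonEntropy_map hY, shannonEntropy_map hXY, Fintype.sum_prod_type]
  have h1 : ∀ a b, P.real ((fun ω => (X ω, Y ω)) ⁻¹' {(a, b)}) =
      P.real (X ⁻¹' {a}) * P.real (Y ⁻¹' {b}) := by
    intro a b
    rw [← Set.singleton_prod_singleton, Set.mk_preimage_prod, Measure.real, Measure.real,
      Measure.real, ← ENNReal.toReal_mul,
      h.measure_inter_preimage_eq_mul _ _ (measurableSet_singleton a) (measurableSet_singleton b)]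
  simp only [h1, Real.negMulLog_mul, Finset.sum_add_distrib, ← Finset.sum_mul, ← Finset.mul_sum,
    sum_measureReal_preimage_eq_one hX, sum_measureReal_preimage_eq_one hY, one_mul]

/-! ### Conditional probabilities and vanishing conditional entropy. -/

lemma integral_comp_eq_sum {L : Ω → β} (hL : Measurable L) (ψ : β → ℝ) :
    ∫ ω, ψ (L ω) ∂P = ∑ b, P.real (L ⁻¹' {b}) * ψ b := by
  rw [← integral_map hL.aemeasurable AEStronglyMeasurable.of_discrete,
    integral_fintype (Integrable.of_finite)]
  refine Finset.sum_congr rfl fun b _ => ?_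
  rw [map_measureReal_apply hL (measurableSet_singleton b), smul_eq_mul]

omit [Fintype α] [MeasurableSpace α] [DiscreteMeasurableSpace α] [Fintype β] [MeasurableSpace β]
  [DiscreteMeasurableSpace β] in
lemma measureReal_prod_le (X : Ω → α) (L : Ω → β) (a : α) (b : β) :
    P.real ((fun ω => (X ω, L ω)) ⁻¹' {(a, b)}) ≤ P.real (L ⁻¹' {b}) :=
  measureReal_mono fun ω h => (Prod.mk.inj h).2

/-- The conditional probability of `X = a` given `L = b`. -/
noncomputable def condProb (P : Measure Ω) (X : Ω → α) (L : Ω → β) (a : α) (b : β) : ℝ :=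
  P.real ((fun ω => (X ω, L ω)) ⁻¹' {(a, b)}) / P.real (L ⁻¹' {b})

omit [Fintype α] [MeasurableSpace α] [DiscreteMeasurableSpace α] [Fintype β] [MeasurableSpace β]
  [DiscreteMeasurableSpace β] in
lemma mul_condProb (X : Ω → α) (L : Ω → β) (a : α) (b : β) :
    P.real (L ⁻¹' {b}) * condProb P X L a b = P.real ((fun ω => (X ω, L ω)) ⁻¹' {(a, b)}) := by
  rcases eq_or_ne (P.real (L ⁻¹' {b})) 0 with h | h
  · rw [h, zero_mul]
    exact le_antisymm measureReal_nonneg (h ▸ measureReal_prod_le X L a b)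
  · rw [condProb, mul_div_cancel₀ _ h]

/-- The conditional expectation of the indicator of `{X = a}` given a finite valued `L`. -/
lemma condProb_ae_eq_condExp {X : Ω → α} {L : Ω → β} (hX : Measurable X) (hL : Measurable L)
    (a : α) :
    (fun ω => condProb P X L a (L ω)) =ᵐ[P]
      P[(X ⁻¹' {a}).indicator (fun _ => (1 : ℝ)) | MeasurableSpace.comap L inferInstance] := by
  classical
  have hXa : MeasurableSet (X ⁻¹' {a}) := hX (measurableSet_singleton a)
  have hφL : StronglyMeasurable[MeasurableSpace.comap L inferInstance]
      fun ω => condProb P X L a (L ω) :=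
    ((measurable_of_finite (condProb P X L a)).comp (comap_measurable L)).stronglyMeasurable
  have hint : Integrable (fun ω => condProb P X L a (L ω)) P :=
    Integrable.comp_measurable (g := condProb P X L a) .of_finite hL
  refine ae_eq_condExp_of_forall_setIntegral_eq hL.comap_le
    ((integrable_const (1 : ℝ)).indicator hXa) (fun s _ _ => hint.integrableOn) ?_
    hφL.aestronglyMeasurable
  rintro _ ⟨t, ht, rfl⟩ -
  rw [integral_indicator hXa, Measure.restrict_restrict hXa, setIntegral_const, smul_eq_mul,
    mul_one, ← integral_indicator (hL ht)]
  have h1 := integral_comp_eq_sum (P := P) hL (t.indicator (condProb P X L a))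
  have h2 := sum_measureReal_preimage_singleton (μ := P) ({a} ×ˢ t.toFinset)
    (f := fun ω => (X ω, L ω)) fun y _ => (hX.prodMk hL) (measurableSet_singleton y)
  have h3 : (fun ω => (X ω, L ω)) ⁻¹' (({a} ×ˢ t.toFinset : Finset (α × β)) : Set (α × β)) =
      X ⁻¹' {a} ∩ L ⁻¹' t := by
    ext ω
    simp [and_comm, eq_comm (a := a)]
  rw [Finset.sum_product, Finset.sum_singleton, h3] at h2
  rw [← h2, ← Finset.sum_congr rfl fun b _ => mul_condProb (P := P) X L a b]
  refine h1.trans ?_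
  simp only [Set.indicator_apply, mul_ite, mul_zero, ← Finset.sum_filter]
  refine Finset.sum_congr ?_ fun _ _ => rfl
  ext
  simp

open Real in
-- The chain rule, in a form where a limit in L can be taken under the integral.
lemma sum_integral_negMulLog_condProb {X : Ω → α} {L : Ω → β} (hX : Measurable X)
    (hL : Measurable L) :
    ∑ a, ∫ ω, negMulLog (condProb P X L a (L ω)) ∂P =
      shannonEntropy (P.map fun ω => (X ω, L ω)) - shannonEntropy (P.map L) := by
  rw [shannonEntropy_map hL, shannonEntropy_map (hX.prodMk hL), Fintype.sum_prod_type,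
    Finset.sum_comm, ← Finset.sum_sub_distrib]
  simp only [fun a => integral_comp_eq_sum (P := P) hL fun b => negMulLog (condProb P X L a b)]
  rw [Finset.sum_comm]
  refine Finset.sum_congr rfl fun b _ => ?_
  rcases eq_or_ne (P.real (L ⁻¹' {b})) 0 with h | h
  · simp [← mul_condProb, h]
  · have h1 : ∑ a, condProb P X L a b = 1 := by
      simp only [condProb, ← Finset.sum_div]
      rw [← measureReal_eq_sum_prod_left hX hL, div_self h]
    simp only [← mul_condProb, negMulLog_mul, Finset.sum_add_distrib, ← Finset.sum_mul, h1,
      ← Finset.mul_sum]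
    ring

end

open Real Filter Topology in
/-- The conditional entropy of `X` given finer and finer information `L n`, which determines `X` in
the limit, tends to `0`. -/
lemma tendsto_shannonEntropy_sub {Ω α : Type*} [MeasurableSpace Ω] {P : Measure Ω}
    [IsProbabilityMeasure P] [Fintype α] [MeasurableSpace α] [DiscreteMeasurableSpace α]
    {β : ℕ → Type*} [∀ n, Fintype (β n)] [∀ n, MeasurableSpace (β n)]
    [∀ n, DiscreteMeasurableSpace (β n)] {X : Ω → α} {L : ∀ n, Ω → β n}
    (hL : ∀ n, Measurable (L n))
    (hmono : Monotone fun n => MeasurableSpace.comap (L n) inferInstance)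
    (hX : Measurable[⨆ n, MeasurableSpace.comap (L n) inferInstance] X) :
    Tendsto (fun n => shannonEntropy (P.map fun ω => (X ω, L n ω)) -
      shannonEntropy (P.map (L n))) atTop (𝓝 0) := by
  have hX' : Measurable X := hX.mono (iSup_le fun n => (hL n).comap_le) le_rfl
  simp only [← fun n => sum_integral_negMulLog_condProb (P := P) hX' (hL n)]
  rw [← Finset.sum_const_zero (s := (Finset.univ : Finset α))]
  refine tendsto_finsetSum _ fun a _ => ?_
  let ℱ : Filtration ℕ (inferInstance : MeasurableSpace Ω) :=
    ⟨fun n => MeasurableSpace.comap (L n) inferInstance, hmono, fun n => (hL n).comap_le⟩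
  set g := (X ⁻¹' {a}).indicator fun _ => (1 : ℝ) with hg
  have hgi : Integrable g P :=
    (integrable_const (1 : ℝ)).indicator (hX' (measurableSet_singleton a))
  have hgm : StronglyMeasurable[⨆ n, ℱ n] g :=
    stronglyMeasurable_const.indicator (hX (measurableSet_singleton a))
  have hae : ∀ᵐ ω ∂P, ∀ n, condProb P X (L n) a (L n ω) = (P[g | ℱ n]) ω :=
    ae_all_iff.2 fun n => condProb_ae_eq_condExp hX' (hL n) a
  -- The limiting conditional probability is an indicator, and `negMulLog` vanishes at 0 and 1.
  have h0 : ∀ ω, negMulLog (g ω) = 0 := fun ω => by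
    by_cases h : ω ∈ X ⁻¹' {a} <;> simp [hg, h]
  rw [← integral_zero Ω ℝ (μ := P), ← funext h0]
  refine tendsto_integral_of_dominated_convergence (fun _ => 1) (fun n => ?_)
    (integrable_const _) (fun n => .of_forall fun ω => ?_) ?_
  · exact ((measurable_of_finite fun b => negMulLog (condProb P X (L n) a b)).comp
      (hL n)).aestronglyMeasurable
  · have h1 : 0 ≤ condProb P X (L n) a (L n ω) := div_nonneg measureReal_nonneg measureReal_nonneg
    have h2 : condProb P X (L n) a (L n ω) ≤ 1 :=
      div_le_one_of_le₀ (measureReal_prod_le _ _ _ _) measureReal_nonneg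
    rw [norm_eq_abs, abs_of_nonneg (negMulLog_nonneg h1 h2)]
    linarith [negMulLog_le_one_sub_self h1]
  · filter_upwards [hae, hgi.tendsto_ae_condExp hgm] with ω h1 h2
    simp only [h1]
    exact (continuous_negMulLog.tendsto _).comp h2

/-! ### Joint entropies of families of variables. -/

section
open scoped Classical
variable {J Ω α : Type*} [MeasurableSpace Ω] {P : Measure Ω} [IsProbabilityMeasure P]
  [Fintype α] [MeasurableSpace α] [DiscreteMeasurableSpace α] {W : J → Ω → α}

omit [IsProbabilityMeasure P] [DiscreteMeasurableSpace α] in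
lemma jointEntropy_def (S : Finset J) : jointEntropy P W S =
    shannonEntropy (P.map fun (ω : Ω) (v : S) => W v ω) := rfl

lemma jointEntropy_union_add_inter_le [inst : DecidableEq J] (hW : ∀ j, Measurable (W j))
    (S S' : Finset J) :
    jointEntropy P W (S ∪ S') + jointEntropy P W (S ∩ S') ≤
      jointEntropy P W S + jointEntropy P W S' := by
  obtain rfl : inst = fun a b => Classical.propDecidable (a = b) := Subsingleton.elim _ _
  have hm : ∀ S : Finset J, Measurable fun (ω : Ω) (v : S) => W v ω := fun S =>
    measurable_pi_lambda _ fun v => hW v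
  have h1 := shannonEntropy_submodular (P := P) (hm S) (hm S')
    (f := Finset.restrict₂ (π := fun _ => α) (Finset.inter_subset_left (s₁ := S) (s₂ := S')))
    (g := Finset.restrict₂ (π := fun _ => α) Finset.inter_subset_right) fun ω => rfl
  have h2 := shannonEntropy_map_comp_injective (P := P) (hm (S ∪ S'))
    (f := fun x => (Finset.restrict₂ (π := fun _ => α) Finset.subset_union_left x,
      Finset.restrict₂ (π := fun _ => α) Finset.subset_union_right x)) (by
    intro x y hxy
    obtain ⟨e1, e2⟩ := Prod.mk.inj hxy
    ext ⟨j, hj⟩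
    rcases Finset.mem_union.1 hj with h | h
    · exact congrFun e1 ⟨j, h⟩
    · exact congrFun e2 ⟨j, h⟩)
  simp only [jointEntropy_def]
  rw [← h2]
  exact h1

lemma jointEntropy_mono (hW : ∀ j, Measurable (W j)) {S S' : Finset J} (h : S ⊆ S') :
    jointEntropy P W S ≤ jointEntropy P W S' := by
  simp only [jointEntropy_def]
  exact shannonEntropy_map_comp_le (P := P) (X := fun (ω : Ω) (v : S') => W v ω)
    (measurable_pi_lambda _ fun v => hW v) (Finset.restrict₂ (π := fun _ => α) h)

lemma jointEntropy_empty : jointEntropy P W ∅ = 0 := by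
  rw [jointEntropy_def, shannonEntropy_map (measurable_pi_lambda _ fun v => by
    exact absurd v.2 (Finset.notMem_empty _))]
  rw [Fintype.sum_unique]
  have : (fun (ω : Ω) (v : (∅ : Finset J)) => W v ω) ⁻¹' {default} = Set.univ :=
    Set.eq_univ_of_forall fun ω => Subsingleton.elim _ _
  simp [this]

omit [IsProbabilityMeasure P] in
lemma jointEntropy_comp_injective {β : Type*} [Fintype β] [MeasurableSpace β]
    [DiscreteMeasurableSpace β] (hW : ∀ j, Measurable (W j)) {e : α → β}
    (he : Function.Injective e) (S : Finset J) :
    jointEntropy P (fun j ω => e (W j ω)) S = jointEntropy P W S := by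
  simp only [jointEntropy_def]
  exact shannonEntropy_map_comp_injective (P := P) (X := fun (ω : Ω) (v : S) => W v ω)
    (measurable_pi_lambda _ fun v => hW v) (he.comp_left (α := S))

omit [IsProbabilityMeasure P] in
lemma jointEntropy_map {I : Type*} (hW : ∀ j, Measurable (W j)) (e : I ↪ J) (S : Finset I) :
    jointEntropy P W (S.map e) = jointEntropy P (fun i => W (e i)) S := by
  simp only [jointEntropy_def]
  refine (shannonEntropy_map_comp_injective (P := P)
    (X := fun (ω : Ω) (v : S.map e) => W v ω) (measurable_pi_lambda _ fun v => hW v)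
    (f := fun x (v : S) => x ⟨e v, Finset.mem_map_of_mem e v.2⟩) ?_).symm
  intro x y hxy
  ext ⟨j, hj⟩
  obtain ⟨i, hi, rfl⟩ := Finset.mem_map.1 hj
  exact congrFun hxy ⟨i, hi⟩

omit [IsProbabilityMeasure P] [DiscreteMeasurableSpace α] in
lemma jointEntropy_congr_law {W' : J → Ω → α} (hW : ∀ j, Measurable (W j))
    (hW' : ∀ j, Measurable (W' j))
    (h : P.map (fun ω j => W j ω) = P.map fun ω j => W' j ω) (S : Finset J) :
    jointEntropy P W S = jointEntropy P W' S := by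
  have hr : Measurable fun (x : J → α) (v : S) => x v :=
    measurable_pi_lambda _ fun v => measurable_pi_apply _
  have e1 := Measure.map_map (μ := P) hr (measurable_pi_lambda (fun ω j => W j ω) hW)
  have e2 := Measure.map_map (μ := P) hr (measurable_pi_lambda (fun ω j => W' j ω) hW')
  rw [jointEntropy_def, jointEntropy_def]
  rw [h] at e1
  exact congrArg _ (e1.symm.trans e2)

lemma jointEntropy_eq_sum (hW : ∀ j, Measurable (W j)) (hind : iIndepFun W P) (S : Finset J) :
    jointEntropy P W S = ∑ j ∈ S, jointEntropy P W {j} := by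
  induction S using Finset.induction_on with
  | empty => simp [jointEntropy_empty]
  | insert j S hj ih =>
    rw [Finset.sum_insert hj, ← ih]
    have hm : ∀ S : Finset J, Measurable fun (ω : Ω) (v : S) => W v ω := fun S =>
      measurable_pi_lambda _ fun v => hW v
    have h1 := shannonEntropy_prod_of_indepFun (hm {j}) (hm S)
      (hind.indepFun_finset {j} S (by simpa using hj) hW)
    simp only [jointEntropy_def]
    rw [← h1]
    refine (shannonEntropy_map_comp_injective (P := P) (hm (insert j S))
      (f := fun x => (Finset.restrict₂ (π := fun _ => α) (s := {j}) (by simp) x,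
        Finset.restrict₂ (π := fun _ => α) (Finset.subset_insert j S) x)) ?_).symm
    intro x y hxy
    obtain ⟨e1, e2⟩ := Prod.mk.inj hxy
    ext ⟨i, hi⟩
    rcases Finset.mem_insert.1 hi with rfl | h
    · exact congrFun e1 ⟨i, Finset.mem_singleton_self i⟩
    · exact congrFun e2 ⟨i, h⟩

end

/-! ### The process together with truncated seeds. -/

instance Sum.instDiscreteMeasurableSpace {α β : Type*} [MeasurableSpace α] [MeasurableSpace β] [DiscreteMeasurableSpace α]
    [DiscreteMeasurableSpace β] : DiscreteMeasurableSpace (α ⊕ β) :=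
  ⟨fun _ => measurableSet_sum_iff.2 ⟨.of_discrete, .of_discrete⟩⟩

/-- The first `n` coordinates of a point with respect to a generating sequence of sets. -/
noncomputable def generatingBits (α : Type*) [MeasurableSpace α]
    [MeasurableSpace.CountablyGenerated α] (n : ℕ) (x : α) : Fin n → Bool :=
  open Classical in fun k => decide (x ∈ MeasurableSpace.natGeneratingSequence α k)

lemma measurable_generatingBits (α : Type*) [MeasurableSpace α]
    [MeasurableSpace.CountablyGenerated α] (n : ℕ) : Measurable (generatingBits α n) := by
  refine measurable_pi_lambda _ fun k => measurable_to_bool ?_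
  convert MeasurableSpace.measurableSet_natGeneratingSequence (α := α) k
  ext x
  simp [generatingBits]

lemma disjSum_map_equiv {V : Type*} (e : V ≃ V) (S A : Finset V) :
    (S.map e.toEmbedding).disjSum (A.map e.toEmbedding) =
      (S.disjSum A).map (Equiv.sumCongr e e).toEmbedding := by
  ext (x | x) <;> simp [Finset.mem_map_equiv]

section
open scoped Classical
variable {V Ω M : Type*} [Fintype M] [MeasurableSpace M] [DiscreteMeasurableSpace M]
  [MeasurableSpace Ω] {P : Measure Ω} [IsProbabilityMeasure P]

/-- The joint family of the process `Y` and of the first `n` bits of the seeds `Z`. -/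
noncomputable def withSeedBits (Y : V → Ω → M) (Z : V → Ω → unitInterval) (n : ℕ) :
    V ⊕ V → Ω → M ⊕ (Fin n → Bool) :=
  Sum.elim (fun v ω => Sum.inl (Y v ω)) fun u ω => Sum.inr (generatingBits unitInterval n (Z u ω))

variable (P) in
/-- The entropy of `Y` on `S` conditioned on the first `n` bits of the seeds `Z` on `A`. -/
noncomputable def seedCondEntropy (Y : V → Ω → M) (Z : V → Ω → unitInterval) (n : ℕ)
    (S A : Finset V) : ℝ :=
  jointEntropy P (withSeedBits Y Z n) (S.disjSum A) -
    jointEntropy P (withSeedBits Y Z n) ((∅ : Finset V).disjSum A)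

variable {Y : V → Ω → M} {Z : V → Ω → unitInterval}

omit [Fintype M] [DiscreteMeasurableSpace M] in
lemma measurable_withSeedBits (hY : ∀ v, Measurable (Y v)) (hZ : ∀ v, Measurable (Z v)) (n : ℕ)
    (j : V ⊕ V) : Measurable (withSeedBits Y Z n j) := by
  rcases j with v | u
  · exact measurable_inl.comp (hY v)
  · exact measurable_inr.comp ((measurable_generatingBits _ n).comp (hZ u))

lemma seedCondEntropy_empty_right (hY : ∀ v, Measurable (Y v)) (hZ : ∀ v, Measurable (Z v))
    (n : ℕ) (S : Finset V) : seedCondEntropy P Y Z n S ∅ = jointEntropy P Y S := by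
  rw [seedCondEntropy, Finset.disjSum_empty, Finset.disjSum_empty, Finset.map_empty,
    jointEntropy_empty, sub_zero, jointEntropy_map (measurable_withSeedBits hY hZ n)]
  exact jointEntropy_comp_injective hY Sum.inl_injective S

omit [IsProbabilityMeasure P] in
lemma jointEntropy_seeds (hY : ∀ v, Measurable (Y v)) (hZ : ∀ v, Measurable (Z v))
    (n : ℕ) (A : Finset V) :
    jointEntropy P (withSeedBits Y Z n) ((∅ : Finset V).disjSum A) =
      jointEntropy P (fun u ω => generatingBits unitInterval n (Z u ω)) A := by
  rw [Finset.empty_disjSum, jointEntropy_map (measurable_withSeedBits hY hZ n)]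
  exact jointEntropy_comp_injective (fun u => (measurable_generatingBits _ n).comp (hZ u))
    (Sum.inr_injective (α := M)) A

omit [Fintype M] [MeasurableSpace M] [DiscreteMeasurableSpace M] [IsProbabilityMeasure P] in
-- The relabelled family is the same function G of the relabelled seeds, whose i.i.d. law is
-- unchanged.
lemma map_withSeedBits {T : SimpleGraph V} [MeasurableSpace M]
    {F : (V → unitInterval) → (V → M)} (hZ : IsIIDUniform P Z) (hF : IsAutFactor T F)
    (hYF : ∀ ω v, Y v ω = F (fun u => Z u ω) v) (γ : T ≃g T) (n : ℕ) :
    P.map (fun ω j => withSeedBits Y Z n (Equiv.sumCongr γ.toEquiv γ.toEquiv j) ω) =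
      P.map fun ω j => withSeedBits Y Z n j ω := by
  let G : (V → unitInterval) → (V ⊕ V → M ⊕ (Fin n → Bool)) := fun z =>
    Sum.elim (fun v => Sum.inl (F z v)) fun u => Sum.inr (generatingBits unitInterval n (z u))
  have hG : Measurable G := by
    refine measurable_pi_lambda _ fun j => ?_
    rcases j with v | u
    · exact measurable_inl.comp ((measurable_pi_apply v).comp hF.measurable)
    · exact measurable_inr.comp ((measurable_generatingBits _ n).comp (measurable_pi_apply u))
  have e1 : (fun ω j => withSeedBits Y Z n j ω) = G ∘ fun ω u => Z u ω := by
    ext ω j : 2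
    rcases j with v | u <;> simp [withSeedBits, G, hYF]
  have e2 : (fun ω j => withSeedBits Y Z n (Equiv.sumCongr γ.toEquiv γ.toEquiv j) ω) =
      G ∘ fun ω u => Z (γ u) ω := by
    ext ω j : 2
    rcases j with v | u
    -- `autAct` precomposes with the inverse, hence `γ.symm`.
    · have h := congrFun (hF.equivariant γ.symm fun u => Z u ω) v
      change Sum.inl (Y (γ v) ω) = Sum.inl (F (fun u => Z (γ u) ω) v)
      rw [hYF]
      exact congrArg Sum.inl h.symm
    · rfl
  rw [e1, e2, ← Measure.map_map hG (measurable_pi_lambda _ fun u => hZ.measurable _),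
    ← Measure.map_map hG (measurable_pi_lambda _ fun u => hZ.measurable _),
    (hZ.indep.precomp γ.injective).map_fun_eq_infinitePi_map (fun u => hZ.measurable _),
    hZ.indep.map_fun_eq_infinitePi_map hZ.measurable]
  simp only [hZ.uniform]

lemma isInvariantCondEntropy_seedCondEntropy {T : SimpleGraph V}
    {F : (V → unitInterval) → (V → M)} (hZ : IsIIDUniform P Z) (hF : IsAutFactor T F)
    (hYF : ∀ ω v, Y v ω = F (fun u => Z u ω) v) (hY : ∀ v, Measurable (Y v)) (n : ℕ) :
    IsInvariantCondEntropy T (seedCondEntropy P Y Z n) where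
  sub_mono S S' h A D := by
    have h1 := jointEntropy_union_add_inter_le (P := P)
      (measurable_withSeedBits hY hZ.measurable n) (S'.disjSum A) (S.disjSum (A ∪ D))
    rw [show S'.disjSum A ∪ S.disjSum (A ∪ D) = S'.disjSum (A ∪ D) by
        ext (x | x) <;> simp <;> grind,
      show S'.disjSum A ∩ S.disjSum (A ∪ D) = S.disjSum A by
        ext (x | x) <;> simp <;> grind] at h1
    simp only [seedCondEntropy]
    linarith
  submodular S A B := by
    have h1 := jointEntropy_union_add_inter_le (P := P)
      (measurable_withSeedBits hY hZ.measurable n) (S.disjSum A) (S.disjSum B)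
    rw [show S.disjSum A ∪ S.disjSum B = S.disjSum (A ∪ B) by
        ext (x | x) <;> simp,
      show S.disjSum A ∩ S.disjSum B = S.disjSum (A ∩ B) by
        ext (x | x) <;> simp] at h1
    -- Independence makes the seed entropies additive, so the subtracted terms balance exactly.
    have h2 := jointEntropy_eq_sum (P := P)
      (W := fun u ω => generatingBits unitInterval n (Z u ω))
      (fun u => (measurable_generatingBits _ n).comp (hZ.measurable u))
      (hZ.indep.comp (fun _ => generatingBits unitInterval n)
        fun _ => measurable_generatingBits _ n)
    have h3 := Finset.sum_union_inter (s₁ := A) (s₂ := B)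
      (f := fun u => jointEntropy P (fun u ω => generatingBits unitInterval n (Z u ω)) {u})
    simp only [← h2] at h3
    simp only [seedCondEntropy, jointEntropy_seeds hY hZ.measurable]
    linarith
  empty A := sub_self _
  nonneg S A := sub_nonneg.2 <| jointEntropy_mono (measurable_withSeedBits hY hZ.measurable n)
    (Finset.disjSum_mono (Finset.empty_subset S) subset_rfl)
  map γ S A := by
    have key : ∀ S A : Finset V, jointEntropy P (withSeedBits Y Z n)
        ((S.map γ.toEquiv.toEmbedding).disjSum (A.map γ.toEquiv.toEmbedding)) =
        jointEntropy P (withSeedBits Y Z n) (S.disjSum A) := by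
      intro S A
      have hm := measurable_withSeedBits hY hZ.measurable n
      rw [disjSum_map_equiv]
      exact (jointEntropy_map hm (Equiv.sumCongr γ.toEquiv γ.toEquiv).toEmbedding _).trans
        (jointEntropy_congr_law (fun j => hm _) hm (map_withSeedBits hZ hF hYF γ n) _)
    have h1 := key ∅ A
    rw [Finset.map_empty] at h1
    rw [seedCondEntropy, key, h1, seedCondEntropy]

open Filter Topology in
-- Bits and vertices are revealed together, so in the limit every seed is known, and with it Y.
lemma tendsto_seedCondEntropy {F : (V → unitInterval) → (V → M)} (hZ : ∀ v, Measurable (Z v))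
    (hF : Measurable F) (hYF : ∀ ω v, Y v ω = F (fun u => Z u ω) v)
    (hY : ∀ v, Measurable (Y v)) (S : Finset V) {B : ℕ → Finset V} (hB : Monotone B)
    (hBV : ∀ u, ∃ n, u ∈ B n) :
    Tendsto (fun n => seedCondEntropy P Y Z n S (B n)) atTop (𝓝 0) := by
  let L : ∀ n, Ω → (B n → Fin n → Bool) := fun n ω u => generatingBits unitInterval n (Z u ω)
  have hL : ∀ n, Measurable (L n) := fun n => measurable_pi_lambda _ fun u =>
    (measurable_generatingBits _ n).comp (hZ u)
  have hmono : Monotone fun n => MeasurableSpace.comap (L n) inferInstance := by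
    intro n m hnm
    refine Measurable.comap_le (m₁ := MeasurableSpace.comap (L m) inferInstance) ?_
    exact (measurable_of_finite fun (l : B m → Fin m → Bool) (u : B n) (k : Fin n) =>
      l ⟨u, hB hnm u.2⟩ (Fin.castLE hnm k)).comp (comap_measurable (L m))
  have hZm : ∀ u, Measurable[⨆ n, MeasurableSpace.comap (L n) inferInstance] (Z u) := by
    intro u
    rw [← MeasurableSpace.generateFrom_natGeneratingSequence unitInterval]
    refine @measurable_generateFrom _ _ (⨆ n, MeasurableSpace.comap (L n) inferInstance) _ _ ?_
    rintro _ ⟨k, rfl⟩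
    obtain ⟨n, hn⟩ := hBV u
    -- Late enough for u to be included and for bit k to be among the revealed bits.
    have hu : u ∈ B (max n (k + 1)) := hB (le_max_left _ _) hn
    refine le_iSup (fun n => MeasurableSpace.comap (L n) inferInstance) (max n (k + 1)) _
      ⟨{l | l ⟨u, hu⟩ ⟨k, by omega⟩ = true}, MeasurableSet.of_discrete, ?_⟩
    ext ω
    simp [L, generatingBits]
  have hX : Measurable[⨆ n, MeasurableSpace.comap (L n) inferInstance]
      fun ω (v : S) => Y v ω := by
    refine @measurable_pi_lambda _ _ _ (_) _ _ fun v => ?_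
    simp only [hYF]
    exact (measurable_pi_apply v.1).comp
      (hF.comp (@measurable_pi_lambda _ _ _ (_) _ _ hZm))
  refine (tendsto_shannonEntropy_sub (P := P) hL hmono hX).congr fun n => ?_
  rw [seedCondEntropy, jointEntropy_seeds hY hZ]
  congr 1
  refine (shannonEntropy_map_comp_injective (P := P)
    (X := fun ω => ((fun (v : S) => Y v ω), L n ω))
    ((measurable_pi_lambda (fun ω (v : S) => Y v ω) fun v => hY v).prodMk (hL n))
    (f := fun x (j : S.disjSum (B n)) => match j with
      | ⟨Sum.inl v, h⟩ => Sum.inl (x.1 ⟨v, Finset.inl_mem_disjSum.1 h⟩)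
      | ⟨Sum.inr u, h⟩ => Sum.inr (x.2 ⟨u, Finset.inr_mem_disjSum.1 h⟩)) ?_).symm.trans ?_
  · rintro ⟨x1, x2⟩ ⟨y1, y2⟩ hxy
    refine Prod.ext ?_ ?_
    · ext v
      exact Sum.inl_injective (congrFun hxy ⟨Sum.inl v.1, Finset.inl_mem_disjSum.2 v.2⟩)
    · ext u : 1
      exact Sum.inr_injective (congrFun hxy ⟨Sum.inr u.1, Finset.inr_mem_disjSum.2 u.2⟩)
  · rw [jointEntropy_def]
    congr!
    rename_i ω j
    obtain ⟨v | u, hj⟩ := j <;> rfl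

end

/-! ### The flower inequalities. -/

section
variable {V Ω M : Type*} {d : ℕ} {T : SimpleGraph V} [T.LocallyFinite] [Fintype M]
  [MeasurableSpace M] [DiscreteMeasurableSpace M] [MeasurableSpace Ω] {P : Measure Ω}
  [IsProbabilityMeasure P] {Y : V → Ω → M}

omit [Fintype M] [DiscreteMeasurableSpace M] [IsProbabilityMeasure P] [T.LocallyFinite] in
lemma IsFactorOfIID.measurable (hY : IsFactorOfIID T P Y) (v : V) : Measurable (Y v) := by
  obtain ⟨Z, F, hZ, hF, hYF⟩ := hY
  rw [show Y v = fun ω => F (fun u => Z u ω) v from funext fun ω => hYF ω v]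
  exact (measurable_pi_apply v).comp
    (hF.measurable.comp (measurable_pi_lambda _ fun u => hZ.measurable u))

lemma IsFlower.exists_subset_neighborFinset {i : ℕ} {S : Finset V} (h : IsFlower T i S) :
    ∃ o, S ⊆ T.neighborFinset o :=
  h.2.imp fun o ho v hv => by simpa using ho v hv

/-- The entropy inequality between flowers with `i` and `i + 1` vertices. -/
lemma IsFactorOfIID.flower_succ_ge (hY : IsFactorOfIID T P Y) (hT : T.IsTree)
    (hreg : T.IsRegularOfDegree d) {i : ℕ} {S S' : Finset V} (hS : IsFlower T i S)
    (hS' : IsFlower T (i + 1) S') (v : V) :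
    ((d : ℝ) - i - 1) * jointEntropy P Y S + ((d : ℝ) - 1) * jointEntropy P Y {v} ≤
      ((d : ℝ) - i) * jointEntropy P Y S' := by
  classical
  have hYm := hY.measurable
  obtain ⟨Z, F, hZ, hF, hYF⟩ := hY
  obtain ⟨o, ho⟩ := hS.exists_subset_neighborFinset
  obtain ⟨o', ho'⟩ := hS'.exists_subset_neighborFinset
  have hball : ∀ v, Monotone fun n => T.finBall n v := fun v =>
    monotone_nat_of_le_succ fun n => hT.finBall_subset_succ n v
  have key : ∀ n, ((d : ℝ) - i - 1) *
      (jointEntropy P Y S - seedCondEntropy P Y Z n S (T.finBall (n + 1) o)) +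
      (d - 1) * (jointEntropy P Y {v} - seedCondEntropy P Y Z n {v} (T.finBall n v)) ≤
      (d - i) * jointEntropy P Y S' := by
    intro n
    have hc := isInvariantCondEntropy_seedCondEntropy hZ hF hYF hYm n
    have h := hc.flower_ge hT hreg ho ho' (by rw [hS.1, hS'.1]) v n
    simpa only [seedCondEntropy_empty_right hYm hZ.measurable, hS.1] using h
  have h1 := tendsto_seedCondEntropy (P := P) hZ.measurable hF.measurable hYF hYm S
    (B := fun n => T.finBall (n + 1) o) (fun a b h => hball o (Nat.succ_le_succ h)) fun u => by
      obtain ⟨n, hn⟩ := hT.exists_mem_finBall o u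
      exact ⟨n, hT.finBall_subset_succ n o hn⟩
  have h2 := tendsto_seedCondEntropy (P := P) hZ.measurable hF.measurable hYF hYm {v}
    (B := fun n => T.finBall n v) (hball v) (hT.exists_mem_finBall v)
  have h3 := ((h1.const_sub (jointEntropy P Y S)).const_mul ((d : ℝ) - i - 1)).add
    ((h2.const_sub (jointEntropy P Y {v})).const_mul ((d : ℝ) - 1))
  rw [sub_zero, sub_zero] at h3
  exact le_of_tendsto h3 (.of_forall key)

/-- All vertices have the same entropy. -/
lemma IsFactorOfIID.jointEntropy_singleton_eq (hY : IsFactorOfIID T P Y) (hT : T.IsTree)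
    (hreg : T.IsRegularOfDegree d) (v w : V) : jointEntropy P Y {v} = jointEntropy P Y {w} := by
  classical
  have hYm := hY.measurable
  obtain ⟨Z, F, hZ, hF, hYF⟩ := hY
  have h := (isInvariantCondEntropy_seedCondEntropy hZ hF hYF hYm 0).eq_vertex hT hreg v w
  simpa only [seedCondEntropy_empty_right hYm hZ.measurable] using h

/-- The coefficients a_i solve (d - i) a_{i+1} = (d - i - 1) a_i + (d - 1) with a_1 = 1, so
`flower_succ_ge` propagates the bound from i to i + 1. -/
lemma IsFactorOfIID.flower_ge (hY : IsFactorOfIID T P Y) (hT : T.IsTree) (hd : 2 ≤ d)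
    (hreg : T.IsRegularOfDegree d) {i : ℕ} (hi : 1 ≤ i) {S : Finset V} (hS : IsFlower T i S)
    (v : V) : ((i : ℝ) * d - 2 * i + 1) / ((d : ℝ) - 1) * jointEntropy P Y {v} ≤
      jointEntropy P Y S := by
  have hd1 : (0 : ℝ) < d - 1 := by
    have : (2 : ℝ) ≤ d := by exact_mod_cast hd
    linarith
  induction i, hi using Nat.le_induction generalizing S with
  | base =>
    obtain ⟨w, rfl⟩ := Finset.card_eq_one.1 hS.1
    rw [hY.jointEntropy_singleton_eq hT hreg w v, Nat.cast_one, one_mul,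
      show (d : ℝ) - 2 * 1 + 1 = d - 1 by ring, div_self hd1.ne', one_mul]
  | succ i hi ih =>
    obtain ⟨o, ho⟩ := hS.exists_subset_neighborFinset
    have hid : i + 1 ≤ d := by
      have := Finset.card_le_card ho
      rwa [hS.1, SimpleGraph.card_neighborFinset_eq_degree, hreg o] at this
    have hid' : (i : ℝ) + 1 ≤ d := by exact_mod_cast hid
    obtain ⟨R, hRS, hR⟩ := Finset.exists_subset_card_eq (show i ≤ S.card by rw [hS.1]; omega)
    have hR' : IsFlower T i R := ⟨hR, hS.2.imp fun o ho v hv => ho v (hRS hv)⟩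
    have h1 := hY.flower_succ_ge hT hreg hR' hS v
    have h2 := mul_le_mul_of_nonneg_left (ih hR') (show (0 : ℝ) ≤ (d : ℝ) - i - 1 by linarith)
    have h3 : ((d : ℝ) - i) * (((i + 1 : ℕ) * d - 2 * (i + 1 : ℕ) + 1) / ((d : ℝ) - 1) *
        jointEntropy P Y {v}) = ((d : ℝ) - i - 1) * (((i : ℝ) * d - 2 * i + 1) / ((d : ℝ) - 1) *
        jointEntropy P Y {v}) + ((d : ℝ) - 1) * jointEntropy P Y {v} := by
      push_cast
      field_simp
      ring
    exact le_of_mul_le_mul_left (by linarith) (show (0 : ℝ) < (d : ℝ) - i by linarith)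

end

theorem mainTheorem4 {V Ω M : Type*} (d : ℕ) (hd : 3 ≤ d)
    (T : SimpleGraph V) [T.LocallyFinite] (hT : T.IsTree) (hreg : T.IsRegularOfDegree d)
    [Fintype M] [MeasurableSpace M] [DiscreteMeasurableSpace M]
    [MeasurableSpace Ω] (P : Measure Ω) [IsProbabilityMeasure P]
    (Y : V → Ω → M) (hY : IsFactorOfIID T P Y) :
    (∀ i : ℕ, 1 ≤ i → i < d → ∀ S S' : Finset V, IsFlower T i S → IsFlower T (i + 1) S' →
      ∀ v : V, ((d : ℝ) - i) * jointEntropy P Y S' ≥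
        ((d : ℝ) - i - 1) * jointEntropy P Y S + ((d : ℝ) - 1) * jointEntropy P Y {v}) ∧
    (∀ i : ℕ, 1 ≤ i → i ≤ d → ∀ S : Finset V, IsFlower T i S →
      ∀ v : V, jointEntropy P Y S ≥
        (((i : ℝ) * d - 2 * i + 1) / ((d : ℝ) - 1)) * jointEntropy P Y {v}) ∧
    (∀ o v : V, jointEntropy P Y (T.neighborFinset o) ≥
      ((d : ℝ) - 1) * jointEntropy P Y {v}) := by
  refine ⟨fun i _ _ S S' hS hS' v => hY.flower_succ_ge hT hreg hS hS' v,
    fun i hi _ S hS v => hY.flower_ge hT (by omega) hreg hi hS v, fun o v => ?_⟩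
  have hd1 : (d : ℝ) - 1 ≠ 0 := by
    have : (3 : ℝ) ≤ d := by exact_mod_cast hd
    linarith
  have h := hY.flower_ge hT (by omega) hreg (i := d) (by omega) (S := T.neighborFinset o)
    ⟨by rw [SimpleGraph.card_neighborFinset_eq_degree, hreg o], o, fun w hw => by simpa using hw⟩ v
  rwa [show ((d : ℝ) * d - 2 * d + 1) / ((d : ℝ) - 1) = d - 1 by field_simp; ring] at h
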